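/- Let $S_1,\dots,S_n$ ($n\ge 1$) be Pauli strings on $m$ qubits, i.e. tensor products of $m$ factors from $\{\mathbb 1,X,Y,Z\}$, and let $G$ be their frustration graph: the graph on $\{1,\dots,n\}$ in which $i\ne j$ are adjacent if and only if $S_i$ and $S_j$ anti-commute. Let $\mathcal D=\{w\in\mathbb R^n: w_i\ge 0,\ \sum_i w_i=1\}$. For $w\in\mathbb R_{\ge0}^n$ put $\beta(G,w)=\sup_\rho\sum_i w_i\,(\operatorname{tr}\rho S_i)^2$, the supremum being over all density matrices $\rho$ (this number depends only on $G$ and $w$), and let $$\delta(\{S_i\})=\min_{w\in\mathcal D}\ \max_{\|\psi\|=1}\ \sum_i w_i\,\langle\psi|S_i|\psi\rangle^2$$ be the sample complexity index of shadow tomography. Let $\bar G$ be the complement of $G$. For a graph $H$ with vertices $1,\dots,n$ let $\alpha^*(H)$ be its fractional packing number, the maximum of $\sum_i w_i$ over all $w\in\mathbb R_{\ge0}^n$ with $\sum_{i\in C}w_i\le 1$ for every clique $C$ of $H$; and let $\vartheta(H)$ be its Lovász number, the minimum of $\max_i \langle c,u_i\rangle^{-2}$ over all unit vectors $c,u_1,\dots,u_n$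 of a Euclidean space such that $u_i\perp u_j$ whenever $i\neq j$ are not adjacent in $H$. Then $$\delta(\{S_i\})=\min_{w\in\mathcal D}\beta(G,w)\in\left[\frac1{\alpha^*(\bar G)},\ \frac1{\vartheta(\bar G)}\right].$$ Call $G$ $\hbar$-perfect if $\mathrm{STAB}(G)=\mathrm{BETA}(G)$. Here $\mathrm{STAB}(G)$ is the convex hull of the indicator vectors of the independent sets of $G$. The set $\mathrm{BETA}(G)$ is $\mathrm{Conv}(\{x\in\mathbb R^n:\exists\rho\ \forall i\ x_i\le(\operatorname{tr}\rho S_i')^2\})\cap\mathbb R_{\ge0}^n$, where $S'_1,\dots,S'_n$ are any Pauli strings with frustration graph $G$ (it does not depend on their choice) and $\rho$ runs over the density matrices. If $G$ is $\hbar$-perfect, then $\delta(\{S_i\})=1/\alpha^*(\bar G)$. -/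

import Mathlib

noncomputable section

namespace PauliShadow

open scoped ComplexOrder

/-- The four single-qubit Pauli symbols. -/
inductive Pauli
  | I | X | Y | Z

/-- The Pauli matrices. -/
def Pauli.toMatrix : Pauli → Matrix (Fin 2) (Fin 2) ℂ
  | .I => !![1, 0; 0, 1]
  | .X => !![0, 1; 1, 0]
  | .Y => !![0, -Complex.I; Complex.I, 0]
  | .Z => !![1, 0; 0, -1]

/-- A Pauli string of length `m`: one Pauli symbol for each of the `m` qubits. -/
abbrev PauliString (m : ℕ) : Type := Fin m → Pauli

/-- The operator of a Pauli string on `m` qubits: the tensor product of its factors, written in the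
computational basis, which is indexed by the bit strings `Fin m → Fin 2`. -/
def PauliString.toMatrix {m : ℕ} (P : PauliString m) :
    Matrix (Fin m → Fin 2) (Fin m → Fin 2) ℂ :=
  Matrix.of fun a b => ∏ k, (P k).toMatrix (a k) (b k)

/-- Density matrices on a finite-dimensional Hilbert space with basis `d`. -/
def IsDensityMatrix {d : Type*} [Fintype d] (ρ : Matrix d d ℂ) : Prop :=
  ρ.PosSemidef ∧ ρ.trace = 1

/-- The expectation value `tr (ρ A)`, a real number for a Hermitian `A`. -/
def expectation {d : Type*} [Fintype d] (ρ A : Matrix d d ℂ) : ℝ :=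
  (ρ * A).trace.re

/-- The expectation value `⟨ψ| A |ψ⟩`, a real number for a Hermitian `A`. -/
def pureExpectation {d : Type*} [Fintype d] (ψ : EuclideanSpace ℂ d) (A : Matrix d d ℂ) : ℝ :=
  (∑ a, ∑ b, star (ψ a) * A a b * ψ b).re

/-- The frustration graph of a family of Pauli strings: distinct indices are adjacent exactly when
the corresponding operators anti-commute. -/
def frustrationGraph {ι : Type*} {m : ℕ} (S : ι → PauliString m) : SimpleGraph ι where
  Adj i j := i ≠ j ∧
    (S i).toMatrix * (S j).toMatrix = -((S j).toMatrix * (S i).toMatrix)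
  symm := ⟨fun _ _ h => ⟨h.1.symm, by rw [h.2, neg_neg]⟩⟩
  loopless := ⟨fun _ h => h.1 rfl⟩

/-- The weighted beta number: the supremum over all states `ρ` of `∑ i, w i * ⟨S i⟩_ρ ^ 2`. -/
def weightedBeta {ι : Type*} [Fintype ι] {m : ℕ} (S : ι → PauliString m) (w : ι → ℝ) : ℝ :=
  ⨆ ρ : {ρ : Matrix (Fin m → Fin 2) (Fin m → Fin 2) ℂ // IsDensityMatrix ρ},
    ∑ i, w i * expectation ρ.1 (S i).toMatrix ^ 2

/-- The sample complexity index of shadow tomography: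
the minimum over probability vectors `w` of the maximum over unit vectors `ψ` of
`∑ i, w i * ⟨ψ| S i |ψ⟩ ^ 2`. -/
def sampleComplexityIndex {ι : Type*} [Fintype ι] {m : ℕ} (S : ι → PauliString m) : ℝ :=
  ⨅ w : stdSimplex ℝ ι, ⨆ ψ : Metric.sphere (0 : EuclideanSpace ℂ (Fin m → Fin 2)) 1,
    ∑ i, w.1 i * pureExpectation ψ.1 (S i).toMatrix ^ 2

/-- The joint variance range: all tuples `(⟨S i⟩_ρ ^ 2)_i` for states `ρ`. -/
def varianceRange {ι : Type*} {m : ℕ} (S : ι → PauliString m) : Set (ι → ℝ) :=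
  {q | ∃ ρ : Matrix (Fin m → Fin 2) (Fin m → Fin 2) ℂ, IsDensityMatrix ρ ∧
    ∀ i, q i = expectation ρ (S i).toMatrix ^ 2}

/-- The beta body of a realization `S`: the nonnegative part of the convex hull of the down-closure
of the joint variance range. -/
def betaBody {ι : Type*} {m : ℕ} (S : ι → PauliString m) : Set (ι → ℝ) :=
  convexHull ℝ (lowerClosure (varianceRange S) : Set (ι → ℝ)) ∩ {x | ∀ i, 0 ≤ x i}

/-- The stable set polytope: the convex hull of the `0`-`1` vectors supported on stable sets. -/
def stableSetPolytope {ι : Type*} (G : SimpleGraph ι) : Set (ι → ℝ) :=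
  convexHull ℝ {v | (∀ i, v i = 0 ∨ v i = 1) ∧ ∀ i j, G.Adj i j → v i * v j = 0}

/-- A graph is ħ-perfect when its stable set polytope is its beta body. All realizations of the
graph by Pauli strings have the same beta body, so it does not matter which one is used. -/
def IsHbarPerfect {ι : Type*} (G : SimpleGraph ι) : Prop :=
  ∃ (m : ℕ) (S : ι → PauliString m), frustrationGraph S = G ∧ stableSetPolytope G = betaBody S

/-- The fractional packing number: the maximum of `∑ i, w i` over nonnegative weights whose sum over
each clique is at most `1`. -/
def fractionalPackingNumber {ι : Type*} [Fintype ι] (G : SimpleGraph ι) : ℝ :=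
  sSup {t | ∃ w : ι → ℝ, (∀ i, 0 ≤ w i) ∧
    (∀ C : Finset ι, G.IsClique (C : Set ι) → ∑ i ∈ C, w i ≤ 1) ∧ t = ∑ i, w i}

/-- An orthonormal representation of a graph: unit vectors, orthogonal for any two distinct
non-adjacent vertices. -/
def IsOrthonormalRepresentation {ι : Type*} (G : SimpleGraph ι) {d : ℕ}
    (u : ι → EuclideanSpace ℝ (Fin d)) : Prop :=
  (∀ i, ‖u i‖ = 1) ∧ ∀ i j, i ≠ j → ¬ G.Adj i j → inner ℝ (u i) (u j) = 0

/-- The Lovász number: the minimum of `max_i 1 / ⟪c, u i⟫ ^ 2` over all orthonormal representations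
`u` of the graph and all unit vectors `c`. The value is infinite, hence irrelevant for the minimum,
if some `⟪c, u i⟫` vanishes. -/
def lovaszNumber {ι : Type*} (G : SimpleGraph ι) : ℝ :=
  sInf {t | ∃ (d : ℕ) (u : ι → EuclideanSpace ℝ (Fin d)) (c : EuclideanSpace ℝ (Fin d)),
    IsOrthonormalRepresentation G u ∧ ‖c‖ = 1 ∧ (∀ i, inner ℝ c (u i) ≠ 0) ∧
    t = ⨆ i, 1 / inner ℝ c (u i) ^ 2}

end PauliShadow

end

open PauliShadow

/- The index `δ` and `1 / α*(Ḡ)` are the minima over the simplex of the support functions of the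
beta body and of the stable set polytope. Commuting Pauli strings have a state on which all of them
have expectation `± 1`, so the polytope lies in the beta body, which gives the lower bound. The two
minima agree when `G` is ħ-perfect, because the beta body does not depend on the realization: the
operators `S' i ⊗ S i` of two realizations commute, and measuring them jointly turns a state for one
into a mixture of states for the other.

For the upper bound, the minimax theorem yields a limit of mixtures of pure states `ψ k` with
weights `p k` whose averages `∑ k, p k * ⟨S i⟩_(ψ k) ^ 2` are all at least `δ`. For each mixture the
vectors `⨁ k, √(p k) ⟨S i⟩_(ψ k) S i ψ k`, normalized, form an orthonormal representation of `Ḡ`,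
and together with `⨁ k, √(p k) ψ k` they bound `ϑ(Ḡ)`. -/

namespace PauliShadow

open Matrix WithLp
open scoped ComplexOrder Kronecker Pointwise

theorem Pauli.toMatrix_mul_self (p : Pauli) : p.toMatrix * p.toMatrix = 1 := by
  cases p <;> simp [Pauli.toMatrix, Matrix.one_fin_two]

theorem Pauli.isHermitian_toMatrix (p : Pauli) : p.toMatrix.IsHermitian := by
  ext a b
  cases p <;> fin_cases a <;> fin_cases b <;> simp [Pauli.toMatrix]

theorem Pauli.exists_mul_eq_units_smul (p q : Pauli) :
    ∃ s : ℤˣ, p.toMatrix * q.toMatrix = s • (q.toMatrix * p.toMatrix) := by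
  cases p <;> cases q <;>
    first
    | (refine ⟨1, ?_⟩; simp [Pauli.toMatrix]; done)
    | (refine ⟨-1, ?_⟩; simp [Pauli.toMatrix])

namespace PauliString

variable {m : ℕ}

theorem toMatrix_mul_apply (P Q : PauliString m) (a b : Fin m → Fin 2) :
    (P.toMatrix * Q.toMatrix) a b = ∏ k, ((P k).toMatrix * (Q k).toMatrix) (a k) (b k) := by
  simp only [Matrix.mul_apply, toMatrix, Matrix.of_apply, ← Finset.prod_mul_distrib]
  rw [Finset.prod_univ_sum, Fintype.piFinset_univ]

theorem toMatrix_mul_self (P : PauliString m) : P.toMatrix * P.toMatrix = 1 := by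
  ext a b
  simp only [toMatrix_mul_apply, Pauli.toMatrix_mul_self, Matrix.one_apply, funext_iff,
    Finset.prod_ite_zero, Finset.prod_const_one, Finset.mem_univ, true_imp_iff]

theorem isHermitian_toMatrix (P : PauliString m) : P.toMatrix.IsHermitian := by
  ext a b
  simp only [Matrix.conjTranspose_apply, toMatrix, Matrix.of_apply, star_prod]
  exact Finset.prod_congr rfl fun k _ => (P k).isHermitian_toMatrix.apply (a k) (b k)

theorem mul_eq_or_eq_neg (P Q : PauliString m) :
    P.toMatrix * Q.toMatrix = Q.toMatrix * P.toMatrix ∨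
      P.toMatrix * Q.toMatrix = -(Q.toMatrix * P.toMatrix) := by
  choose s hs using fun k => (P k).exists_mul_eq_units_smul (Q k)
  have hprod : P.toMatrix * Q.toMatrix = (∏ k, s k) • (Q.toMatrix * P.toMatrix) := by
    ext a b
    simp only [Matrix.smul_apply, toMatrix_mul_apply, hs, Finset.prod_smul]
  rcases Int.units_eq_one_or (∏ k, s k) with h | h <;> rw [h] at hprod
  · exact Or.inl (by simpa using hprod)
  · exact Or.inr (by simpa using hprod)

end PauliString

theorem commute_of_not_adj {ι : Type*} {m : ℕ} {S : ι → PauliString m} {i j : ι}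
    (h : ¬(frustrationGraph S).Adj i j) : Commute (S i).toMatrix (S j).toMatrix := by
  rcases eq_or_ne i j with rfl | hij
  · exact Commute.refl _
  · exact (PauliString.mul_eq_or_eq_neg (S i) (S j)).resolve_right fun hneg => h ⟨hij, hneg⟩

section SignProjection

variable {ι A : Type*} [Fintype ι] [CommRing A] [Algebra ℂ A]

/-- For commuting involutions `T i`, the projection `∏ i, (1 + s i • T i) / 2` onto the joint
eigenspace on which every `T i` acts as the sign `s i`. -/
noncomputable def signProjection (T : ι → A) (s : ι → ℤˣ) : A :=
  ∏ i, (2⁻¹ : ℂ) • (1 + s i • T i)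

theorem sum_signProjection [DecidableEq ι] (T : ι → A) : ∑ s, signProjection T s = 1 := by
  have hfactor (i : ι) : ∑ s : ℤˣ, (2⁻¹ : ℂ) • (1 + s • T i) = 1 := by
    simp [UnitsInt.univ]
    module
  unfold signProjection
  rw [← Fintype.prod_sum fun i s => (2⁻¹ : ℂ) • (1 + s • T i)]
  exact Finset.prod_eq_one fun i _ => hfactor i

theorem star_signProjection [StarRing A] [StarModule ℂ A] {T : ι → A}
    (hT : ∀ i, IsSelfAdjoint (T i)) (s : ι → ℤˣ) :
    star (signProjection T s) = signProjection T s := by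
  simp [signProjection, star_prod, Units.smul_def, (hT _).star_eq]

variable {T : ι → A} (hT : ∀ i, T i * T i = 1)
include hT

theorem signProjection_mul_self (s : ι → ℤˣ) :
    signProjection T s * signProjection T s = signProjection T s := by
  rw [signProjection, ← Finset.prod_mul_distrib]
  refine Finset.prod_congr rfl fun i _ => ?_
  rcases Int.units_eq_one_or (s i) with h | h <;>
    simp [h, mul_add, add_mul, hT] <;> module

theorem mul_signProjection (s : ι → ℤˣ) (i : ι) :
    T i * signProjection T s = s i • signProjection T s := by
  classical
  have hfactor : T i * (2⁻¹ : ℂ) • (1 + s i • T i) = s i • (2⁻¹ : ℂ) • (1 + s i • T i) := by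
    rcases Int.units_eq_one_or (s i) with h | h <;> simp [h, mul_add, hT, add_comm]
  rw [signProjection, ← Finset.mul_prod_erase _ _ (Finset.mem_univ i), ← mul_assoc, hfactor,
    smul_mul_assoc]

end SignProjection

open scoped IsMulCommutative in
theorem exists_joint_spectral_resolution {ι d : Type*} [Fintype ι] [Fintype d] [DecidableEq d]
    [DecidableEq ι] {T : ι → Matrix d d ℂ} (hT : ∀ i, (T i).IsHermitian)
    (hT_sq : ∀ i, T i * T i = 1) (hcomm : ∀ i j, Commute (T i) (T j)) :
    ∃ P : (ι → ℤˣ) → Matrix d d ℂ, (∀ s, (P s).PosSemidef) ∧ ∑ s, P s = 1 ∧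
      ∀ s i, T i * P s = s i • P s := by
  let A := StarAlgebra.adjoin ℂ (Set.range T)
  have : IsMulCommutative A := by
    refine StarAlgebra.isMulCommutative_adjoin ℂ ?_ ?_
    all_goals
      rintro _ ⟨i, rfl⟩ _ ⟨j, rfl⟩
    · exact hcomm i j
    · rw [star_eq_conjTranspose, (hT j).eq]
      exact hcomm i j
  let T' (i : ι) : A := ⟨T i, StarAlgebra.subset_adjoin ℂ _ ⟨i, rfl⟩⟩
  have hT' (i : ι) : IsSelfAdjoint (T' i) := Subtype.ext (hT i)
  have hT'_sq (i : ι) : T' i * T' i = 1 := Subtype.ext (hT_sq i)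
  refine ⟨fun s => (signProjection T' s : A), fun s => ?_, ?_, fun s i => ?_⟩
  · have hP : (signProjection T' s : A) = star (signProjection T' s) * signProjection T' s := by
      rw [star_signProjection hT', signProjection_mul_self hT'_sq]
    beta_reduce
    rw [hP]
    exact posSemidef_conjTranspose_mul_self _
  · rw [← AddSubmonoidClass.coe_finsetSum, sum_signProjection]
    rfl
  · exact congrArg Subtype.val (mul_signProjection hT'_sq s i)

section States

variable {d : Type*} [Fintype d]

theorem pureExpectation_eq_re_dotProduct (ψ : EuclideanSpace ℂ d) (A : Matrix d d ℂ) :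
    pureExpectation ψ A = (star ψ.ofLp ⬝ᵥ A *ᵥ ψ.ofLp).re := by
  simp only [pureExpectation, dotProduct, mulVec, Finset.mul_sum, mul_assoc, Pi.star_apply]

theorem pureExpectation_neg (ψ : EuclideanSpace ℂ d) (A : Matrix d d ℂ) :
    pureExpectation ψ (-A) = -pureExpectation ψ A := by
  simp only [pureExpectation_eq_re_dotProduct, neg_mulVec, dotProduct_neg, Complex.neg_re]

theorem pureExpectation_one [DecidableEq d] (ψ : EuclideanSpace ℂ d) :
    pureExpectation ψ (1 : Matrix d d ℂ) = ‖ψ‖ ^ 2 := by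
  rw [pureExpectation_eq_re_dotProduct, one_mulVec, dotProduct_comm,
    ← EuclideanSpace.inner_eq_star_dotProduct]
  exact inner_self_eq_norm_sq (𝕜 := ℂ) ψ

theorem isDensityMatrix_vecMulVec {ψ : EuclideanSpace ℂ d} (hψ : ‖ψ‖ = 1) :
    IsDensityMatrix (vecMulVec ψ.ofLp (star ψ.ofLp)) := by
  refine ⟨posSemidef_vecMulVec_self_star _, ?_⟩
  rw [trace_vecMulVec, ← EuclideanSpace.inner_eq_star_dotProduct, inner_self_eq_norm_sq_to_K, hψ]
  simp

theorem expectation_vecMulVec (ψ : EuclideanSpace ℂ d) (A : Matrix d d ℂ) :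
    expectation (vecMulVec ψ.ofLp (star ψ.ofLp)) A = pureExpectation ψ A := by
  rw [expectation, vecMulVec_mul, trace_vecMulVec, dotProduct_comm, ← dotProduct_mulVec,
    pureExpectation_eq_re_dotProduct]

theorem IsDensityMatrix.exists_expectation_eq_sum {ρ : Matrix d d ℂ}
    (hρ : IsDensityMatrix ρ) :
    ∃ p ∈ stdSimplex ℝ d, ∃ ψ : d → EuclideanSpace ℂ d, (∀ k, ‖ψ k‖ = 1) ∧
      ∀ A, expectation ρ A = ∑ k, p k * pureExpectation (ψ k) A := by
  classical
  have hH := hρ.1.isHermitian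
  let ψ := hH.eigenvectorBasis
  refine ⟨hH.eigenvalues, ⟨hρ.1.eigenvalues_nonneg, ?_⟩, ψ, ψ.norm_eq_one, fun A => ?_⟩
  · have htr := hH.trace_eq_sum_eigenvalues
    rw [hρ.2] at htr
    simpa using (congrArg Complex.re htr).symm
  · have hterm (k : d) : star (ψ k).ofLp ⬝ᵥ (A * ρ) *ᵥ (ψ k).ofLp =
        hH.eigenvalues k * (star (ψ k).ofLp ⬝ᵥ A *ᵥ (ψ k).ofLp) := by
      rw [← mulVec_mulVec, hH.mulVec_eigenvectorBasis, mulVec_smul, dotProduct_smul]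
      rfl
    have htr : (ρ * A).trace = ∑ k, star (ψ k).ofLp ⬝ᵥ (A * ρ) *ᵥ (ψ k).ofLp := by
      rw [trace_mul_comm, ← trace_toLin_eq _ (EuclideanSpace.basisFun d ℂ).toBasis,
        ← toEuclideanLin_eq_toLin_orthonormal, LinearMap.trace_eq_sum_inner _ ψ]
      refine Finset.sum_congr rfl fun k _ => ?_
      rw [EuclideanSpace.inner_eq_star_dotProduct, dotProduct_comm, toLpLin_apply]
    simp only [expectation, htr, hterm, Complex.re_sum, Complex.re_ofReal_mul,
      pureExpectation_eq_re_dotProduct]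

theorem exists_isDensityMatrix_of_posSemidef [Nonempty d] {τ : Matrix d d ℂ}
    (hτ : τ.PosSemidef) :
    ∃ ρ, IsDensityMatrix ρ ∧ ∀ A, expectation τ A = τ.trace.re * expectation ρ A := by
  classical
  obtain ⟨k⟩ := ‹Nonempty d›
  by_cases h : τ.trace = 0
  · refine ⟨_, isDensityMatrix_vecMulVec (ψ := EuclideanSpace.single k 1) (by simp), fun A => ?_⟩
    simp [hτ.trace_eq_zero_iff.1 h, expectation]
  · refine ⟨τ.trace⁻¹ • τ, ⟨hτ.smul (inv_nonneg.2 hτ.trace_nonneg), ?_⟩, fun A => ?_⟩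
    · rw [trace_smul, smul_eq_mul, inv_mul_cancel₀ h]
    · have htrace : (τ.trace.re : ℂ) = τ.trace := Complex.eq_re_of_ofReal_le hτ.trace_nonneg |>.symm
      rw [expectation, expectation, ← Complex.re_ofReal_mul, htrace, smul_mul_assoc, trace_smul,
        smul_eq_mul, mul_inv_cancel_left₀ h]

theorem inner_toLp_toLp (x y : d → ℂ) :
    inner ℝ (toLp 2 x : EuclideanSpace ℂ d) (toLp 2 y) = (star x ⬝ᵥ y).re := by
  simp [PiLp.inner_apply, Complex.inner, dotProduct, mul_comm]

theorem inner_mulVec_mulVec (ψ : EuclideanSpace ℂ d) (A B : Matrix d d ℂ) :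
    inner ℝ (toLp 2 (A *ᵥ ψ.ofLp) : EuclideanSpace ℂ d) (toLp 2 (B *ᵥ ψ.ofLp)) =
      pureExpectation ψ (Aᴴ * B) := by
  rw [inner_toLp_toLp, star_mulVec, ← dotProduct_mulVec, mulVec_mulVec,
    pureExpectation_eq_re_dotProduct]

theorem inner_mulVec_right (ψ : EuclideanSpace ℂ d) (A : Matrix d d ℂ) :
    inner ℝ ψ (toLp 2 (A *ᵥ ψ.ofLp)) = pureExpectation ψ A := by
  rw [pureExpectation_eq_re_dotProduct, ← inner_toLp_toLp, toLp_ofLp]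

theorem norm_mulVec_of_mul_self_eq_one [DecidableEq d] {A : Matrix d d ℂ} (hA : A.IsHermitian)
    (hA_sq : A * A = 1) (ψ : EuclideanSpace ℂ d) :
    ‖(toLp 2 (A *ᵥ ψ.ofLp) : EuclideanSpace ℂ d)‖ = ‖ψ‖ := by
  rw [← sq_eq_sq₀ (norm_nonneg _) (norm_nonneg _), ← real_inner_self_eq_norm_sq,
    inner_mulVec_mulVec, hA.eq, hA_sq, pureExpectation_one]

theorem pureExpectation_sq_le_one [DecidableEq d] {A : Matrix d d ℂ} (hA : A.IsHermitian)
    (hA_sq : A * A = 1) {ψ : EuclideanSpace ℂ d} (hψ : ‖ψ‖ = 1) : pureExpectation ψ A ^ 2 ≤ 1 := by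
  rw [sq_le_one_iff_abs_le_one, ← inner_mulVec_right]
  simpa only [norm_mulVec_of_mul_self_eq_one hA hA_sq, hψ, one_mul] using
    abs_real_inner_le_norm ψ (toLp 2 (A *ᵥ ψ.ofLp))

theorem inner_mulVec_mulVec_eq_zero_of_anticommute {A B : Matrix d d ℂ} (hA : A.IsHermitian)
    (hB : B.IsHermitian) (hAB : A * B = -(B * A)) (ψ : EuclideanSpace ℂ d) :
    inner ℝ (toLp 2 (A *ᵥ ψ.ofLp) : EuclideanSpace ℂ d) (toLp 2 (B *ᵥ ψ.ofLp)) = 0 := by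
  have h := real_inner_comm (toLp 2 (A *ᵥ ψ.ofLp) : EuclideanSpace ℂ d) (toLp 2 (B *ᵥ ψ.ofLp))
  simp only [inner_mulVec_mulVec, hA.eq, hB.eq, hAB, pureExpectation_neg] at h ⊢
  linarith

end States

section ConvexLowerSets

variable {ι : Type*}

theorem isLowerSet_convexHull {s : Set (ι → ℝ)} (hs : IsLowerSet s) :
    IsLowerSet (convexHull ℝ s) := by
  intro x y hyx hx
  have hsub : (y - x) +ᵥ s ⊆ s := by
    rintro _ ⟨z, hz, rfl⟩
    exact hs (add_le_of_nonpos_left (sub_nonpos.2 hyx)) hz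
  refine convexHull_mono hsub ?_
  rw [convexHull_vadd]
  exact ⟨x, hx, sub_add_cancel y x⟩

theorem sum_smul_sq_mem_of_convex_of_isLowerSet {κ : Type*} [Fintype κ] {C : Set (ι → ℝ)}
    (hC : Convex ℝ C) (hC_lower : IsLowerSet C) {p : κ → ℝ} (hp : p ∈ stdSimplex ℝ κ)
    {y : κ → ι → ℝ} (hy : ∀ k, y k ^ 2 ∈ C) : (∑ k, p k • y k) ^ 2 ∈ C := by
  refine hC_lower (fun i => ?_)
    (hC.sum_mem (fun k _ => hp.1 k) hp.2 fun k _ => hy k)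
  simpa using Real.pow_arith_mean_le_arith_mean_pow_of_even Finset.univ p (fun k => y k i)
    (fun k _ => hp.1 k) hp.2 even_two

variable [Fintype ι]

theorem convex_setOf_dotProduct_le (w : ι → ℝ) (b : ℝ) : Convex ℝ {x | w ⬝ᵥ x ≤ b} :=
  convex_halfSpace_le ⟨dotProduct_add w, fun c x => dotProduct_smul c w x⟩ b

theorem isLowerSet_setOf_dotProduct_le {w : ι → ℝ} (hw : 0 ≤ w) (b : ℝ) :
    IsLowerSet {x | w ⬝ᵥ x ≤ b} :=
  fun _ _ hyx hx => (dotProduct_le_dotProduct_of_nonneg_left hyx hw).trans hx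

/-- The upper bounds of the support function `w ↦ sup_{x ∈ K} w ⬝ᵥ x` of `K` at some probability
vector `w`; the infimum of this set is the minimum of the support function over the simplex,
and unlike that expression it never involves the supremum of an unbounded set. -/
def simplexUpperBounds (K : Set (ι → ℝ)) : Set ℝ :=
  {b | ∃ w ∈ stdSimplex ℝ ι, ∀ x ∈ K, w ⬝ᵥ x ≤ b}

theorem simplexUpperBounds_anti {K L : Set (ι → ℝ)} (h : K ⊆ L) :
    simplexUpperBounds L ⊆ simplexUpperBounds K :=
  fun _ ⟨w, hw, hb⟩ => ⟨w, hw, fun x hx => hb x (h hx)⟩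

theorem exists_isSaddlePointOn_dotProduct [Nonempty ι] {K : Set (ι → ℝ)} (hK : IsCompact K)
    (hK_convex : Convex ℝ K) (hK_nonempty : K.Nonempty) :
    ∃ w ∈ stdSimplex ℝ ι, ∃ x ∈ K, IsSaddlePointOn (stdSimplex ℝ ι) K (· ⬝ᵥ ·) w x := by
  classical
  have hsimplex : Convex ℝ (stdSimplex ℝ ι) := convex_stdSimplex ℝ ι
  refine Sion.exists_isSaddlePointOn
    ⟨_, single_mem_stdSimplex ℝ (Classical.arbitrary ι)⟩ hsimplex (isCompact_stdSimplex ℝ ι)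
    (fun x _ => ?_) (fun x _ => ?_) hK_convex hK_nonempty hK (fun w _ => ?_) (fun w _ => ?_)
  · exact Continuous.lowerSemicontinuous (by fun_prop) |>.lowerSemicontinuousOn _
  · exact (((dotProductBilin ℝ ℝ).flip x).convexOn hsimplex).quasiconvexOn
  · exact Continuous.upperSemicontinuous (by fun_prop) |>.upperSemicontinuousOn _
  · exact ((dotProductBilin ℝ ℝ w).concaveOn hK_convex).quasiconcaveOn

theorem exists_isLeast_simplexUpperBounds [Nonempty ι] {K : Set (ι → ℝ)}
    (hK : Bornology.IsBounded K) (hK_nonempty : K.Nonempty) :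
    ∃ t, IsLeast (simplexUpperBounds K) t ∧ ∃ x ∈ closedConvexHull ℝ K, ∀ i, t ≤ x i := by
  classical
  have hcompact : IsCompact (closedConvexHull ℝ K) := by
    rw [closedConvexHull_eq_closure_convexHull]
    exact (isBounded_convexHull.2 hK).isCompact_closure
  obtain ⟨w, hw, x, hx, hsaddle⟩ := exists_isSaddlePointOn_dotProduct hcompact
    convex_closedConvexHull (hK_nonempty.mono subset_closedConvexHull)
  refine ⟨w ⬝ᵥ x, ⟨⟨w, hw, fun y hy => hsaddle w hw y (subset_closedConvexHull hy)⟩, ?_⟩,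
    x, hx, fun i => ?_⟩
  · rintro b ⟨v, hv, hb⟩
    have hhull : closedConvexHull ℝ K ⊆ {y | v ⬝ᵥ y ≤ b} :=
      closedConvexHull_min hb (convex_setOf_dotProduct_le v b)
        (isClosed_le (by fun_prop) continuous_const)
    exact (hsaddle v hv x hx).trans (hhull hx)
  · simpa only [single_one_dotProduct] using hsaddle _ (single_mem_stdSimplex ℝ i) x hx

end ConvexLowerSets

section VarianceRange

variable {ι : Type*} {m : ℕ} {S : ι → PauliString m}

/-- The part of the joint variance range that comes from pure states, over which
`sampleComplexityIndex` takes its maximum. -/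
def pureVarianceRange (S : ι → PauliString m) : Set (ι → ℝ) :=
  (fun ψ i => pureExpectation ψ (S i).toMatrix ^ 2) ''
    Metric.sphere (0 : EuclideanSpace ℂ (Fin m → Fin 2)) 1

theorem pureVarianceRange_nonempty (S : ι → PauliString m) : (pureVarianceRange S).Nonempty :=
  Set.Nonempty.image _ (NormedSpace.sphere_nonempty.2 zero_le_one)

theorem pureVarianceRange_subset_Icc (S : ι → PauliString m) :
    pureVarianceRange S ⊆ Set.Icc 0 1 := by
  rintro _ ⟨ψ, hψ, rfl⟩
  exact ⟨fun i => sq_nonneg _, fun i => pureExpectation_sq_le_one (S i).isHermitian_toMatrix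
    (S i).toMatrix_mul_self (mem_sphere_zero_iff_norm.1 hψ)⟩

theorem pureVarianceRange_subset_varianceRange (S : ι → PauliString m) :
    pureVarianceRange S ⊆ varianceRange S := by
  rintro _ ⟨ψ, hψ, rfl⟩
  exact ⟨_, isDensityMatrix_vecMulVec (mem_sphere_zero_iff_norm.1 hψ), fun i => by
    rw [expectation_vecMulVec]⟩

theorem varianceRange_subset_betaBody (S : ι → PauliString m) :
    varianceRange S ⊆ betaBody S := by
  rintro q ⟨ρ, hρ, hq⟩
  exact ⟨subset_convexHull ℝ _ (subset_lowerClosure ⟨ρ, hρ, hq⟩), fun i => hq i ▸ sq_nonneg _⟩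

section ConvexLowerSet

variable {C : Set (ι → ℝ)} (hC : Convex ℝ C) (hC_lower : IsLowerSet C)
include hC hC_lower

theorem varianceRange_subset_of_convex_of_isLowerSet (h : pureVarianceRange S ⊆ C) :
    varianceRange S ⊆ C := by
  rintro q ⟨ρ, hρ, hq⟩
  obtain ⟨p, hp, ψ, hψ, hexp⟩ := hρ.exists_expectation_eq_sum
  have hmem := sum_smul_sq_mem_of_convex_of_isLowerSet hC hC_lower hp
    (y := fun k i => pureExpectation (ψ k) (S i).toMatrix)
    fun k => h ⟨ψ k, mem_sphere_zero_iff_norm.2 (hψ k), rfl⟩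
  convert hmem using 1
  ext i
  simp [hq, hexp]

theorem betaBody_subset_of_convex_of_isLowerSet (h : varianceRange S ⊆ C) : betaBody S ⊆ C :=
  Set.inter_subset_left.trans (convexHull_min (lowerClosure_min h hC_lower) hC)

end ConvexLowerSet

variable [Fintype ι]

theorem simplexUpperBounds_betaBody (S : ι → PauliString m) :
    simplexUpperBounds (betaBody S) = simplexUpperBounds (pureVarianceRange S) := by
  refine (simplexUpperBounds_anti ((pureVarianceRange_subset_varianceRange S).trans
    (varianceRange_subset_betaBody S))).antisymm ?_
  rintro b ⟨w, hw, hb⟩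
  have hC := convex_setOf_dotProduct_le w b
  have hC_lower := isLowerSet_setOf_dotProduct_le hw.1 b
  exact ⟨w, hw, betaBody_subset_of_convex_of_isLowerSet hC hC_lower
    (varianceRange_subset_of_convex_of_isLowerSet hC hC_lower hb)⟩

theorem isLUB_weightedBeta (S : ι → PauliString m) {w : ι → ℝ} (hw : 0 ≤ w) :
    IsLUB ((w ⬝ᵥ ·) '' pureVarianceRange S) (weightedBeta S w) := by
  have hupper : upperBounds ((w ⬝ᵥ ·) '' varianceRange S) =
      upperBounds ((w ⬝ᵥ ·) '' pureVarianceRange S) := by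
    have hsub := pureVarianceRange_subset_varianceRange S
    refine (upperBounds_mono_set (Set.image_mono hsub)).antisymm fun b hb =>
      Set.forall_mem_image.2 ?_
    exact varianceRange_subset_of_convex_of_isLowerSet (convex_setOf_dotProduct_le w b)
      (isLowerSet_setOf_dotProduct_le hw b) fun x hx => hb ⟨x, hx, rfl⟩
  have hsSup : weightedBeta S w = sSup ((w ⬝ᵥ ·) '' varianceRange S) := by
    have hrange : varianceRange S = Set.range fun
        (ρ : {ρ : Matrix (Fin m → Fin 2) (Fin m → Fin 2) ℂ // IsDensityMatrix ρ}) i =>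
          expectation ρ.1 (S i).toMatrix ^ 2 := by
      ext q
      simp [varianceRange, funext_iff, eq_comm]
    rw [hrange, ← Set.range_comp]
    rfl
  have hbdd : w ⬝ᵥ 1 ∈ upperBounds ((w ⬝ᵥ ·) '' pureVarianceRange S) :=
    Set.forall_mem_image.2 fun x hx => dotProduct_le_dotProduct_of_nonneg_left
      (pureVarianceRange_subset_Icc S hx).2 hw
  rw [hsSup, ← isLUB_congr hupper]
  exact isLUB_csSup (((pureVarianceRange_nonempty S).mono
    (pureVarianceRange_subset_varianceRange S)).image _) ⟨_, hupper ▸ hbdd⟩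

theorem sampleComplexityIndex_eq_sInf (S : ι → PauliString m) :
    sampleComplexityIndex S = sInf (weightedBeta S '' stdSimplex ℝ ι) := by
  rw [sInf_image']
  refine iInf_congr fun w => ?_
  rw [← (isLUB_weightedBeta S w.2.1).csSup_eq ((pureVarianceRange_nonempty S).image _),
    pureVarianceRange, Set.image_image, sSup_image']
  rfl

theorem simplexUpperBounds_pureVarianceRange (S : ι → PauliString m) :
    simplexUpperBounds (pureVarianceRange S) =
      upperClosure (weightedBeta S '' stdSimplex ℝ ι) := by
  ext b
  simp only [simplexUpperBounds, SetLike.mem_coe, mem_upperClosure, Set.exists_mem_image]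
  refine exists_congr fun w => and_congr_right fun hw => ?_
  rw [isLUB_le_iff (isLUB_weightedBeta S hw.1), mem_upperBounds, Set.forall_mem_image]

theorem isLeast_simplexUpperBounds_pureVarianceRange_iff {t : ℝ} :
    IsLeast (simplexUpperBounds (pureVarianceRange S)) t ↔
      IsLeast (weightedBeta S '' stdSimplex ℝ ι) t := by
  rw [simplexUpperBounds_pureVarianceRange]
  constructor
  · rintro ⟨ht, hlb⟩
    obtain ⟨b, hb, hbt⟩ := mem_upperClosure.1 ht
    rw [lowerBounds_upperClosure] at hlb
    obtain rfl := hbt.antisymm (hlb hb)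
    exact ⟨hb, hlb⟩
  · rintro ⟨ht, hlb⟩
    exact ⟨subset_upperClosure ht, by rwa [lowerBounds_upperClosure]⟩

variable [Nonempty ι]

theorem exists_isLeast_simplexUpperBounds_pureVarianceRange (S : ι → PauliString m) :
    ∃ t, IsLeast (simplexUpperBounds (pureVarianceRange S)) t ∧
      ∃ x ∈ closedConvexHull ℝ (pureVarianceRange S), ∀ i, t ≤ x i :=
  exists_isLeast_simplexUpperBounds
    ((Metric.isBounded_Icc 0 1).subset (pureVarianceRange_subset_Icc S))
    (pureVarianceRange_nonempty S)

theorem isLeast_sampleComplexityIndex (S : ι → PauliString m) :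
    IsLeast (weightedBeta S '' stdSimplex ℝ ι) (sampleComplexityIndex S) := by
  obtain ⟨t, ht, -⟩ := exists_isLeast_simplexUpperBounds_pureVarianceRange S
  rw [isLeast_simplexUpperBounds_pureVarianceRange_iff] at ht
  rwa [sampleComplexityIndex_eq_sInf, ht.csInf_eq]

theorem isLeast_simplexUpperBounds_betaBody (S : ι → PauliString m) :
    IsLeast (simplexUpperBounds (betaBody S)) (sampleComplexityIndex S) := by
  rw [simplexUpperBounds_betaBody, isLeast_simplexUpperBounds_pureVarianceRange_iff]
  exact isLeast_sampleComplexityIndex S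

theorem exists_mem_closedConvexHull_sampleComplexityIndex_le (S : ι → PauliString m) :
    ∃ x ∈ closedConvexHull ℝ (pureVarianceRange S), ∀ i, sampleComplexityIndex S ≤ x i := by
  obtain ⟨t, ht, hx⟩ := exists_isLeast_simplexUpperBounds_pureVarianceRange S
  rw [isLeast_simplexUpperBounds_pureVarianceRange_iff] at ht
  rwa [(isLeast_sampleComplexityIndex S).unique ht]

end VarianceRange

section Realization

theorem commute_kronecker_of_frustrationGraph_eq {ι : Type*} {m m' : ℕ} {S : ι → PauliString m}
    {S' : ι → PauliString m'} (h : frustrationGraph S' = frustrationGraph S) (i j : ι) :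
    Commute ((S' i).toMatrix ⊗ₖ (S i).toMatrix) ((S' j).toMatrix ⊗ₖ (S j).toMatrix) := by
  rw [Commute, SemiconjBy, ← mul_kronecker_mul, ← mul_kronecker_mul]
  by_cases hij : (frustrationGraph S).Adj i j
  · have hij' : (frustrationGraph S').Adj i j := h ▸ hij
    rw [hij.2, hij'.2]
    ext a b
    simp
  · have hij' : ¬(frustrationGraph S').Adj i j := h ▸ hij
    rw [(commute_of_not_adj hij).eq, (commute_of_not_adj hij').eq]

section PartialTrace

variable {d d' : Type*} [Fintype d']

/-- The partial trace over the first tensor factor, as the sum of the diagonal blocks; it turns a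
state of the composite system into the state of the second subsystem. -/
def partialTraceLeft (R : Matrix (d' × d) (d' × d) ℂ) : Matrix d d ℂ :=
  ∑ a, R.submatrix (Prod.mk a) (Prod.mk a)

theorem posSemidef_partialTraceLeft {R : Matrix (d' × d) (d' × d) ℂ} (hR : R.PosSemidef) :
    (partialTraceLeft R).PosSemidef :=
  posSemidef_sum _ fun _ _ => hR.submatrix _

theorem trace_partialTraceLeft_mul [Fintype d] [DecidableEq d'] (R : Matrix (d' × d) (d' × d) ℂ)
    (X : Matrix d d ℂ) :
    (partialTraceLeft R * X).trace = (R * ((1 : Matrix d' d' ℂ) ⊗ₖ X)).trace := by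
  rw [partialTraceLeft, Finset.sum_mul, Matrix.trace_sum]
  simp [Matrix.trace, Matrix.mul_apply, Fintype.sum_prod_type, Matrix.one_apply]

end PartialTrace

variable {d d' : Type*} [Fintype d] [Fintype d']

open scoped MatrixOrder in
theorem exists_posSemidef_trace_mul_eq_trace_kronecker_mul {ρ : Matrix d' d' ℂ}
    {P : Matrix (d' × d) (d' × d) ℂ} (hρ : ρ.PosSemidef) (hP : P.PosSemidef) :
    ∃ τ : Matrix d d ℂ, τ.PosSemidef ∧ ∀ X, (τ * X).trace = ((ρ ⊗ₖ X) * P).trace := by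
  classical
  obtain ⟨C, rfl⟩ := CStarAlgebra.nonneg_iff_eq_star_mul_self.1 hρ.nonneg
  let D : Matrix (d' × d) (d' × d) ℂ := C ⊗ₖ 1
  refine ⟨partialTraceLeft (D * P * Dᴴ),
    posSemidef_partialTraceLeft (hP.mul_mul_conjTranspose_same D), fun X => ?_⟩
  calc (partialTraceLeft (D * P * Dᴴ) * X).trace
      = (D * P * Dᴴ * ((1 : Matrix d' d' ℂ) ⊗ₖ X)).trace := trace_partialTraceLeft_mul _ X
    _ = (Dᴴ * ((1 : Matrix d' d' ℂ) ⊗ₖ X) * D * P).trace := by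
        rw [mul_assoc (D * P), trace_mul_comm, ← mul_assoc]
    _ = (((star C * C) ⊗ₖ X) * P).trace := by
        simp only [D, star_eq_conjTranspose, conjTranspose_kronecker, conjTranspose_one,
          ← mul_kronecker_mul, one_mul, mul_one]

section Steering

variable [DecidableEq d] [DecidableEq d'] {ι : Type*} [Fintype ι] [DecidableEq ι]
  {A : ι → Matrix d' d' ℂ} {B : ι → Matrix d d ℂ}
  (hA : ∀ i, (A i).IsHermitian) (hB : ∀ i, (B i).IsHermitian) (hA_sq : ∀ i, A i * A i = 1)
  (hB_sq : ∀ i, B i * B i = 1) (hcomm : ∀ i j, Commute (A i ⊗ₖ B i) (A j ⊗ₖ B j))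
  {ρ : Matrix d' d' ℂ} (hρ : IsDensityMatrix ρ)
include hA hB hA_sq hB_sq hcomm hρ

/- With `P s` the joint spectral projections of the commuting `A i ⊗ₖ B i`, the choice
`tr (σ s X) = tr ((ρ ⊗ₖ X) P s)` works because `(A i ⊗ₖ B i) P s = s i P s` lets `P s` trade
`1 ⊗ₖ B i` for `s i • (A i ⊗ₖ 1)`. -/
theorem exists_posSemidef_sum_expectation_eq_of_commute_kronecker :
    ∃ σ : (ι → ℤˣ) → Matrix d d ℂ, (∀ s, (σ s).PosSemidef) ∧
      ∑ s, (σ s).trace = Fintype.card d ∧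
      ∀ i, ∑ s, (s i : ℤ) * expectation (σ s) (B i) = expectation ρ (A i) * Fintype.card d := by
  obtain ⟨P, hP, hP_sum, hTP⟩ := exists_joint_spectral_resolution (T := fun i => A i ⊗ₖ B i)
    (fun i => by rw [IsHermitian, conjTranspose_kronecker, (hA i).eq, (hB i).eq])
    (fun i => by rw [← mul_kronecker_mul, hA_sq, hB_sq, one_kronecker_one]) hcomm
  choose σ hσ hσ_trace using fun s =>
    exists_posSemidef_trace_mul_eq_trace_kronecker_mul hρ.1 (hP s)
  have hsum (X : Matrix d' d' ℂ) : ∑ s, ((X ⊗ₖ 1) * P s).trace = X.trace * Fintype.card d := by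
    rw [← Matrix.trace_sum, ← Finset.mul_sum, hP_sum, mul_one, trace_kronecker, trace_one]
  refine ⟨σ, hσ, ?_, fun i => ?_⟩
  · have hσ_one (s : ι → ℤˣ) : (σ s).trace = ((ρ ⊗ₖ 1) * P s).trace := by
      rw [← hσ_trace, mul_one]
    simp only [hσ_one, hsum, hρ.2, one_mul]
  · have hflip (s : ι → ℤˣ) : (s i : ℤ) * expectation (σ s) (B i) =
        (((ρ * A i) ⊗ₖ 1) * P s).trace.re := by
      have hBP : (ρ ⊗ₖ B i) * P s = s i • (((ρ * A i) ⊗ₖ 1) * P s) := by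
        rw [← mul_smul_comm, ← hTP s i, ← mul_assoc, ← mul_kronecker_mul, mul_assoc, hA_sq, mul_one,
          one_mul]
      rw [expectation, hσ_trace, hBP]
      rcases Int.units_eq_one_or (s i) with hs | hs <;> simp [hs]
    simp_rw [hflip]
    rw [← Complex.re_sum, hsum]
    simp [expectation]

theorem exists_expectation_eq_sum_of_commute_kronecker [Nonempty d] :
    ∃ p ∈ stdSimplex ℝ (ι → ℤˣ), ∃ τ : (ι → ℤˣ) → Matrix d d ℂ, (∀ s, IsDensityMatrix (τ s)) ∧
      ∀ i, expectation ρ (A i) = ∑ s, p s * ((s i : ℤ) * expectation (τ s) (B i)) := by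
  obtain ⟨σ, hσ, hσ_sum, hexp⟩ :=
    exists_posSemidef_sum_expectation_eq_of_commute_kronecker hA hB hA_sq hB_sq hcomm hρ
  choose τ hτ hστ using fun s => exists_isDensityMatrix_of_posSemidef (hσ s)
  have hcard : (0 : ℝ) < Fintype.card d := Nat.cast_pos.2 Fintype.card_pos
  refine ⟨fun s => (σ s).trace.re / Fintype.card d, ⟨fun s => ?_, ?_⟩, τ, hτ, fun i => ?_⟩
  · exact div_nonneg (Complex.le_def.1 (hσ s).trace_nonneg).1 hcard.le
  · rw [← Finset.sum_div, ← Complex.re_sum, hσ_sum, Complex.natCast_re, div_self hcard.ne']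
  · rw [eq_div_of_mul_eq hcard.ne' (hexp i).symm, Finset.sum_div]
    refine Finset.sum_congr rfl fun s _ => ?_
    rw [hστ]
    ring

end Steering

variable {ι : Type*} [Finite ι] {m m' : ℕ} {S : ι → PauliString m} {S' : ι → PauliString m'}

theorem varianceRange_subset_of_frustrationGraph_eq
    (h : frustrationGraph S' = frustrationGraph S) {C : Set (ι → ℝ)} (hC : Convex ℝ C)
    (hC_lower : IsLowerSet C) (hSC : varianceRange S ⊆ C) : varianceRange S' ⊆ C := by
  classical
  have := Fintype.ofFinite ι
  rintro q ⟨ρ, hρ, hq⟩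
  obtain ⟨p, hp, τ, hτ, hexp⟩ := exists_expectation_eq_sum_of_commute_kronecker
    (fun i => (S' i).isHermitian_toMatrix) (fun i => (S i).isHermitian_toMatrix)
    (fun i => (S' i).toMatrix_mul_self) (fun i => (S i).toMatrix_mul_self)
    (commute_kronecker_of_frustrationGraph_eq h) hρ
  have hmem := sum_smul_sq_mem_of_convex_of_isLowerSet hC hC_lower hp
    (y := fun s i => (s i : ℤ) * expectation (τ s) (S i).toMatrix)
    fun s => hSC ⟨τ s, hτ s, fun i => ?_⟩
  · convert hmem using 1
    ext i
    simp [hq, hexp]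
  · rcases Int.units_eq_one_or (s i) with hs | hs <;> simp [hs]

theorem betaBody_subset_of_frustrationGraph_eq (h : frustrationGraph S' = frustrationGraph S) :
    betaBody S' ⊆ betaBody S := by
  have hC := convex_convexHull ℝ (lowerClosure (varianceRange S) : Set (ι → ℝ))
  have hC_lower := isLowerSet_convexHull (lowerClosure (varianceRange S)).lower
  refine Set.subset_inter (betaBody_subset_of_convex_of_isLowerSet hC hC_lower ?_)
    Set.inter_subset_right
  exact varianceRange_subset_of_frustrationGraph_eq h hC hC_lower
    (subset_lowerClosure.trans (subset_convexHull ℝ _))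

theorem IsHbarPerfect.stableSetPolytope_eq_betaBody
    (h : IsHbarPerfect (frustrationGraph S)) :
    stableSetPolytope (frustrationGraph S) = betaBody S := by
  obtain ⟨m', S', hS', hstab⟩ := h
  exact hstab.trans ((betaBody_subset_of_frustrationGraph_eq hS').antisymm
    (betaBody_subset_of_frustrationGraph_eq hS'.symm))

end Realization

section StableSets

theorem exists_isDensityMatrix_forall_expectation_sq_eq_one {ι d : Type*} [Finite ι] [Fintype d]
    [DecidableEq d] [Nonempty d] {T : ι → Matrix d d ℂ} (hT : ∀ i, (T i).IsHermitian)
    (hT_sq : ∀ i, T i * T i = 1) (hcomm : ∀ i j, Commute (T i) (T j)) :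
    ∃ ρ, IsDensityMatrix ρ ∧ ∀ i, expectation ρ (T i) ^ 2 = 1 := by
  classical
  have := Fintype.ofFinite ι
  obtain ⟨P, hP, hP_sum, hTP⟩ := exists_joint_spectral_resolution hT hT_sq hcomm
  obtain ⟨s, -, hs⟩ : ∃ s ∈ Finset.univ, P s ≠ 0 :=
    Finset.exists_ne_zero_of_sum_ne_zero (hP_sum ▸ one_ne_zero)
  have htrace : 0 < (P s).trace.re := (Complex.lt_def.1
    ((hP s).trace_nonneg.lt_of_ne' (mt (hP s).trace_eq_zero_iff.1 hs))).1
  obtain ⟨ρ, hρ, hPρ⟩ := exists_isDensityMatrix_of_posSemidef (hP s)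
  refine ⟨ρ, hρ, fun i => ?_⟩
  have hsign : (P s).trace.re * expectation ρ (T i) = (P s).trace.re * (s i : ℤ) := by
    rw [← hPρ, expectation, trace_mul_comm, hTP]
    rcases Int.units_eq_one_or (s i) with h | h <;> simp [h]
  rw [mul_left_cancel₀ htrace.ne' hsign]
  rcases Int.units_eq_one_or (s i) with h | h <;> simp [h]

theorem convex_betaBody {ι : Type*} {m : ℕ} (S : ι → PauliString m) : Convex ℝ (betaBody S) :=
  (convex_convexHull ℝ _).inter (convex_Ici 0)

theorem stableSetPolytope_subset_betaBody {ι : Type*} [Finite ι] {m : ℕ} (S : ι → PauliString m) :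
    stableSetPolytope (frustrationGraph S) ⊆ betaBody S := by
  refine convexHull_min ?_ (convex_betaBody S)
  rintro v ⟨hv, hv_stable⟩
  obtain ⟨ρ, hρ, hexp⟩ := exists_isDensityMatrix_forall_expectation_sq_eq_one
    (T := fun i : {i // v i = 1} => (S i).toMatrix) (fun i => (S i).isHermitian_toMatrix)
    (fun i => (S i).toMatrix_mul_self)
    fun i j => commute_of_not_adj fun hij => by simpa [i.2, j.2] using hv_stable i j hij
  refine ⟨subset_convexHull ℝ _ (mem_lowerClosure.2 ⟨_, ⟨ρ, hρ, fun i => rfl⟩, fun i => ?_⟩),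
    fun i => ?_⟩
  · rcases hv i with hi | hi
    · exact hi ▸ sq_nonneg _
    · exact hi.trans_le (hexp ⟨i, hi⟩).ge
  · rcases hv i with hi | hi <;> simp [hi]

variable {ι : Type*} [Fintype ι] {G : SimpleGraph ι}

theorem forall_mem_stableSetPolytope_dotProduct_le_iff {w : ι → ℝ} {b : ℝ} :
    (∀ x ∈ stableSetPolytope G, w ⬝ᵥ x ≤ b) ↔
      ∀ C : Finset ι, Gᶜ.IsClique (C : Set ι) → ∑ i ∈ C, w i ≤ b := by
  classical
  refine ⟨fun h C hC => ?_, fun h => convexHull_min ?_ (convex_setOf_dotProduct_le w b)⟩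
  · have hmem : (fun i => if i ∈ C then (1 : ℝ) else 0) ∈ stableSetPolytope G := by
      refine subset_convexHull ℝ _ ⟨fun i => ?_, fun i j hij => ?_⟩
      · by_cases hi : i ∈ C <;> simp [hi]
      by_contra! hne
      simp only [ne_eq, mul_eq_zero, ite_eq_right_iff, one_ne_zero, imp_false, not_or,
        not_not] at hne
      exact (hC hne.1 hne.2 hij.ne).2 hij
    simpa [dotProduct] using h _ hmem
  · rintro v ⟨hv, hv_stable⟩
    have hclique : Gᶜ.IsClique (({i | v i = 1} : Finset ι) : Set ι) := by
      intro i hi j hj hij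
      simp only [Finset.coe_filter, Finset.mem_univ, true_and, Set.mem_ofPred_eq] at hi hj
      exact (G.compl_adj i j).2 ⟨hij, fun hadj => by simpa [hi, hj] using hv_stable i j hadj⟩
    refine le_of_eq_of_le ?_ (h _ hclique)
    rw [Finset.sum_filter]
    refine Finset.sum_congr rfl fun i _ => ?_
    rcases hv i with hi | hi <;> simp [hi]

theorem bddAbove_fractionalPacking (G : SimpleGraph ι) :
    BddAbove {t | ∃ w : ι → ℝ, (∀ i, 0 ≤ w i) ∧
      (∀ C : Finset ι, G.IsClique (C : Set ι) → ∑ i ∈ C, w i ≤ 1) ∧ t = ∑ i, w i} := by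
  refine ⟨∑ _i : ι, 1, ?_⟩
  rintro _ ⟨w, -, hC, rfl⟩
  exact Finset.sum_le_sum fun i _ => by simpa using hC {i} (by simp)

theorem sum_le_mul_fractionalPackingNumber {w : ι → ℝ} (hw : 0 ≤ w) {b : ℝ} (hb : 0 < b)
    (h : ∀ C : Finset ι, G.IsClique (C : Set ι) → ∑ i ∈ C, w i ≤ b) :
    ∑ i, w i ≤ b * fractionalPackingNumber G := by
  rw [← div_le_iff₀' hb, Finset.sum_div]
  refine le_csSup (bddAbove_fractionalPacking G)
    ⟨fun i => w i / b, fun i => div_nonneg (hw i) hb.le, fun C hC => ?_, rfl⟩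
  rw [← Finset.sum_div, div_le_one hb]
  exact h C hC

theorem fractionalPackingNumber_pos [Nonempty ι] (G : SimpleGraph ι) :
    0 < fractionalPackingNumber G := by
  classical
  let w : ι → ℝ := Pi.single (Classical.arbitrary ι) 1
  have hw : w ∈ stdSimplex ℝ ι := single_mem_stdSimplex ℝ _
  have hle := sum_le_mul_fractionalPackingNumber (G := G) hw.1 one_pos fun C _ =>
    (Finset.sum_le_univ_sum_of_nonneg hw.1).trans_eq hw.2
  rw [hw.2, one_mul] at hle
  exact one_pos.trans_le hle

theorem isGLB_simplexUpperBounds_stableSetPolytope [Nonempty ι] (G : SimpleGraph ι) :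
    IsGLB (simplexUpperBounds (stableSetPolytope G)) (1 / fractionalPackingNumber Gᶜ) := by
  have hα := fractionalPackingNumber_pos Gᶜ
  constructor
  · rintro b ⟨w, hw, hb⟩
    rw [forall_mem_stableSetPolytope_dotProduct_le_iff] at hb
    obtain ⟨i, -, hi⟩ : ∃ i ∈ Finset.univ, w i ≠ 0 :=
      Finset.exists_ne_zero_of_sum_ne_zero (hw.2 ▸ one_ne_zero)
    have hb_pos : 0 < b := ((hw.1 i).lt_of_ne' hi).trans_le (by simpa using hb {i} (by simp))
    rw [div_le_iff₀ hα, ← hw.2]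
    exact sum_le_mul_fractionalPackingNumber hw.1 hb_pos hb
  · intro l hl
    rcases le_or_gt l 0 with hl0 | hl0
    · exact hl0.trans (one_div_pos.2 hα).le
    rw [le_one_div hl0 hα]
    refine Real.sSup_le ?_ (one_div_pos.2 hl0).le
    rintro _ ⟨w, hw, hC, rfl⟩
    rcases (Finset.sum_nonneg fun i _ => hw i).eq_or_lt with hsum | hsum
    · exact hsum ▸ (one_div_pos.2 hl0).le
    rw [le_one_div hsum hl0]
    refine hl ⟨fun i => w i / ∑ j, w j, ⟨fun i => div_nonneg (hw i) hsum.le, ?_⟩, ?_⟩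
    · rw [← Finset.sum_div, div_self hsum.ne']
    · refine forall_mem_stableSetPolytope_dotProduct_le_iff.2 fun C hC' => ?_
      rw [← Finset.sum_div]
      exact div_le_div_of_nonneg_right (hC C hC') hsum.le

end StableSets

section Lovasz

variable {ι : Type*} {E : Type*} [NormedAddCommGroup E] [InnerProductSpace ℝ E]

theorem lovaszNumber_le_iSup [FiniteDimensional ℝ E] {G : SimpleGraph ι} {u : ι → E} {c : E}
    (hu : ∀ i, ‖u i‖ = 1) (hperp : ∀ i j, i ≠ j → ¬G.Adj i j → inner ℝ (u i) (u j) = 0)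
    (hc : ‖c‖ = 1) (hcu : ∀ i, inner ℝ c (u i) ≠ 0) :
    lovaszNumber G ≤ ⨆ i, 1 / inner ℝ c (u i) ^ 2 := by
  let e := (stdOrthonormalBasis ℝ E).repr
  refine csInf_le ⟨0, ?_⟩ ⟨_, e ∘ u, e c, ⟨fun i => (e.norm_map _).trans (hu i),
    fun i j hij hadj => (e.inner_map_map _ _).trans (hperp i j hij hadj)⟩,
    (e.norm_map c).trans hc, fun i => by simpa using hcu i, by simp⟩
  rintro _ ⟨d, u, c, -, -, -, rfl⟩
  exact Real.iSup_nonneg fun i => by positivity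

theorem one_le_lovaszNumber [Finite ι] [Nonempty ι] (G : SimpleGraph ι) : 1 ≤ lovaszNumber G := by
  have e := Finite.equivFin ι
  let c : EuclideanSpace ℝ (Fin (Nat.card ι)) := toLp 2 1
  have hc : c ≠ 0 := fun h => by
    simpa [c] using congrFun (congrArg ofLp h) (e (Classical.arbitrary ι))
  refine le_csInf ⟨_, _, fun i => EuclideanSpace.single (e i) 1, ‖c‖⁻¹ • c,
    ⟨fun i => ?_, fun i j hij _ => ?_⟩, norm_smul_inv_norm hc, fun i => ?_, rfl⟩ ?_
  · simp
  · simp [EuclideanSpace.inner_single_left, hij]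
  · simp [EuclideanSpace.inner_single_right, inner_smul_left, hc, c]
  rintro _ ⟨d, u, c, ⟨hu, -⟩, hc, hcu, rfl⟩
  refine le_ciSup_of_le (Set.finite_range _).bddAbove (Classical.arbitrary ι) ?_
  rw [le_div_iff₀ (sq_pos_of_ne_zero (hcu _)), one_mul, sq_le_one_iff_abs_le_one]
  simpa [hu, hc] using abs_real_inner_le_norm c (u (Classical.arbitrary ι))

theorem exists_norm_sq_le_one_div_lovaszNumber [Finite ι] [Nonempty ι] [FiniteDimensional ℝ E]
    {G : SimpleGraph ι} {v : ι → E} {c : E} (hc : ‖c‖ = 1)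
    (hcv : ∀ i, inner ℝ c (v i) = ‖v i‖ ^ 2)
    (hperp : ∀ i j, i ≠ j → ¬G.Adj i j → inner ℝ (v i) (v j) = 0) :
    ∃ i, ‖v i‖ ^ 2 ≤ 1 / lovaszNumber G := by
  have hϑ : 0 < lovaszNumber G := one_pos.trans_le (one_le_lovaszNumber G)
  by_cases! h : ∃ i, v i = 0
  · obtain ⟨i, hi⟩ := h
    exact ⟨i, by simp [hi, hϑ.le]⟩
  have hcu (i : ι) : inner ℝ c (‖v i‖⁻¹ • v i) = ‖v i‖ := by
    rw [real_inner_smul_right, hcv, sq, inv_mul_cancel_left₀ (norm_ne_zero_iff.2 (h i))]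
  have hle := lovaszNumber_le_iSup (G := G) (u := fun i => ‖v i‖⁻¹ • v i)
    (fun i => norm_smul_inv_norm (h i))
    (fun i j hij hadj => by simp [real_inner_smul_left, real_inner_smul_right, hperp i j hij hadj])
    hc (fun i => by simp [hcu, h])
  obtain ⟨i, hi⟩ := exists_eq_ciSup_of_finite (f := fun i => 1 / inner ℝ c (‖v i‖⁻¹ • v i) ^ 2)
  rw [← hi, hcu] at hle
  exact ⟨i, (le_one_div (by simp [h i]) hϑ).2 hle⟩

end Lovasz

section Mixtures

variable {ι : Type*} {m : ℕ} {S : ι → PauliString m}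

theorem exists_inner_eq_norm_sq_of_mem_stdSimplex {d K : Type*} [Fintype d]
    [DecidableEq d] [Fintype K] {A : ι → Matrix d d ℂ} (hA : ∀ i, (A i).IsHermitian)
    (hA_sq : ∀ i, A i * A i = 1) {p : K → ℝ} (hp : p ∈ stdSimplex ℝ K)
    {ψ : K → EuclideanSpace ℂ d} (hψ : ∀ k, ‖ψ k‖ = 1) :
    ∃ (c : PiLp 2 fun _ : K => EuclideanSpace ℂ d) (v : ι → PiLp 2 fun _ : K => EuclideanSpace ℂ d),
      ‖c‖ = 1 ∧ (∀ i, inner ℝ c (v i) = ‖v i‖ ^ 2) ∧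
      (∀ i, ‖v i‖ ^ 2 = ∑ k, p k * pureExpectation (ψ k) (A i) ^ 2) ∧
      ∀ i j, A i * A j = -(A j * A i) → inner ℝ (v i) (v j) = 0 := by
  have hnorm (i : ι) (k : K) : ‖(toLp 2 (A i *ᵥ (ψ k).ofLp) : EuclideanSpace ℂ d)‖ = 1 := by
    rw [norm_mulVec_of_mul_self_eq_one (hA i) (hA_sq i), hψ]
  let c : PiLp 2 fun _ : K => EuclideanSpace ℂ d := toLp 2 fun k => √(p k) • ψ k
  let v (i : ι) : PiLp 2 fun _ : K => EuclideanSpace ℂ d :=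
    toLp 2 fun k => (√(p k) * pureExpectation (ψ k) (A i)) • toLp 2 (A i *ᵥ (ψ k).ofLp)
  have hv (i : ι) : ‖v i‖ ^ 2 = ∑ k, p k * pureExpectation (ψ k) (A i) ^ 2 := by
    simp [v, PiLp.norm_sq_eq_of_L2, norm_smul, hnorm, mul_pow, Real.sq_sqrt (hp.1 _)]
  refine ⟨c, v, ?_, fun i => ?_, hv, fun i j hij => ?_⟩
  · rw [← sq_eq_sq₀ (norm_nonneg c) zero_le_one, one_pow, ← hp.2]
    simp [c, PiLp.norm_sq_eq_of_L2, norm_smul, hψ, Real.sq_sqrt (hp.1 _)]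
  · rw [hv, PiLp.inner_apply]
    refine Finset.sum_congr rfl fun k _ => ?_
    rw [real_inner_smul_left, real_inner_smul_right, inner_mulVec_right]
    linear_combination pureExpectation (ψ k) (A i) ^ 2 * Real.mul_self_sqrt (hp.1 k)
  · simp only [v, PiLp.inner_apply (𝕜 := ℝ) (ι := K), real_inner_smul_left, real_inner_smul_right,
      inner_mulVec_mulVec_eq_zero_of_anticommute (hA i) (hA j) hij,
      mul_zero, Finset.sum_const_zero]

variable [Finite ι] [Nonempty ι]

theorem exists_le_one_div_lovaszNumber_of_mem_convexHull {x : ι → ℝ}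
    (hx : x ∈ convexHull ℝ (pureVarianceRange S)) :
    ∃ i, x i ≤ 1 / lovaszNumber (frustrationGraph S)ᶜ := by
  obtain ⟨K, _, p, z, hp, hp_sum, hz, rfl⟩ := mem_convexHull_iff_exists_fintype.1 hx
  choose ψ hψ hzψ using hz
  obtain ⟨c, v, hc, hcv, hv, hperp⟩ := exists_inner_eq_norm_sq_of_mem_stdSimplex
    (fun i => (S i).isHermitian_toMatrix) (fun i => (S i).toMatrix_mul_self) ⟨hp, hp_sum⟩
    fun k => mem_sphere_zero_iff_norm.1 (hψ k)
  obtain ⟨i, hi⟩ := exists_norm_sq_le_one_div_lovaszNumber (G := (frustrationGraph S)ᶜ) hc hcv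
    fun i j hij hadj => hperp i j (by simpa [hij] using hadj : (frustrationGraph S).Adj i j).2
  refine ⟨i, le_of_eq_of_le ?_ hi⟩
  simp [hv, ← hzψ]

theorem exists_le_one_div_lovaszNumber_of_mem_closedConvexHull {x : ι → ℝ}
    (hx : x ∈ closedConvexHull ℝ (pureVarianceRange S)) :
    ∃ i, x i ≤ 1 / lovaszNumber (frustrationGraph S)ᶜ := by
  have hclosed : IsClosed {x : ι → ℝ | ∃ i, x i ≤ 1 / lovaszNumber (frustrationGraph S)ᶜ} := by
    rw [Set.ofPred_exists]
    exact isClosed_iUnion_of_finite fun i => isClosed_le (continuous_apply i) continuous_const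
  rw [closedConvexHull_eq_closure_convexHull] at hx
  exact closure_minimal (fun x => exists_le_one_div_lovaszNumber_of_mem_convexHull) hclosed hx

end Mixtures

theorem sampleComplexityIndex_le_one_div_lovaszNumber {ι : Type*} [Fintype ι] [Nonempty ι] {m : ℕ}
    (S : ι → PauliString m) :
    sampleComplexityIndex S ≤ 1 / lovaszNumber (frustrationGraph S)ᶜ := by
  obtain ⟨x, hx, hle⟩ := exists_mem_closedConvexHull_sampleComplexityIndex_le S
  obtain ⟨i, hi⟩ := exists_le_one_div_lovaszNumber_of_mem_closedConvexHull hx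
  exact (hle i).trans hi

end PauliShadow

theorem theorem5 {ι : Type*} [Fintype ι] [Nonempty ι] {m : ℕ} (S : ι → PauliString m) :
    IsLeast (weightedBeta S '' stdSimplex ℝ ι) (sampleComplexityIndex S) ∧
    sampleComplexityIndex S ∈
      Set.Icc (1 / fractionalPackingNumber (frustrationGraph S)ᶜ)
        (1 / lovaszNumber (frustrationGraph S)ᶜ) ∧
    (IsHbarPerfect (frustrationGraph S) →
      sampleComplexityIndex S = 1 / fractionalPackingNumber (frustrationGraph S)ᶜ) := by
  have hα := isGLB_simplexUpperBounds_stableSetPolytope (frustrationGraph S)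
  have hδ := isLeast_simplexUpperBounds_betaBody S
  refine ⟨isLeast_sampleComplexityIndex S,
    ⟨?_, sampleComplexityIndex_le_one_div_lovaszNumber S⟩, fun hG => ?_⟩
  · exact hα.1 (simplexUpperBounds_anti (stableSetPolytope_subset_betaBody S) hδ.1)
  · rw [hG.stableSetPolytope_eq_betaBody] at hα
    exact hδ.isGLB.unique hα
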